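/- In the bin covering problem, for a finite list $L=(a_1,\dots,a_N)$ of non-negative item sizes let $\mathrm{OPT}(L)$ be the maximal number of pairwise disjoint sets $X_1,\dots,X_\ell\subseteq\{1,\dots,N\}$ with $\sum_{i\in X_j}a_i\ge 1$ for every $j$, let $s(L)=\sum_i a_i$, and let $W^{\mathrm{OPT}}(L)=s(L)-\mathrm{OPT}(L)$. Let $\mathrm{DNF}(L)$ be the number of bins filled by Dual Next-Fit, which puts arriving items into the same bin until its total size is at least $1$ and then continues with a new empty bin. For a permutation $\sigma\in S_N$ let $\sigma(L)$ be the correspondingly permuted list; $\mathbb{E}_\sigma$ is the expectation over a uniformly random permutation. A discrete distribution $F$ is given by finitely many non-negative rational item sizes $s_1,\dots,s_m$ and positive rational probabilities $p_1,\dots,p_m$ with $\sum_i p_i=1$; $I_n(F)$ is a list of $n$ items drawn i.i.d. according to $F$. $F$ is a perfect-packing distribution if $\mathbb{E}[W^{\mathrm{OPT}}(I_n(F))]=o(n)$. $F$ is nontrivial if some $s_i>0$. For nontrivial $F$ let $$\mathrm{AECR}(F)=\liminf_{n\to\infty}\frac{\mathbb{E}[\mathrm{DNF}(I_n(F))]}{\mathbb{E}[\mathrm{OPT}(I_n(F))]}.$$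 (1) For every list $L$ of items in $[0,1]$ with $\mathrm{OPT}(L)\ge 1$ there is a list $H$ of items in $[0,1]$ with $\mathrm{OPT}(H)\ge 1$ and $W^{\mathrm{OPT}}(H)=0$ such that $$\frac{\mathbb{E}_\sigma[\mathrm{DNF}(\sigma(L))]}{\mathrm{OPT}(L)}\ \ge\ \frac{\mathbb{E}_\sigma[\mathrm{DNF}(\sigma(H))]}{\mathrm{OPT}(H)}.$$ (2) For every nontrivial discrete distribution $F$ there is a nontrivial perfect-packing distribution $G$ such that both of the following limits exist and $$\lim_{n\to\infty}\frac{\mathbb{E}[\mathrm{DNF}(I_n(F))]}{\mathbb{E}[\mathrm{OPT}(I_n(F))]}\ \ge\ \lim_{n\to\infty}\frac{\mathbb{E}[\mathrm{DNF}(I_n(G))]}{\mathbb{E}[\mathrm{OPT}(I_n(G))]}.$$ (3) Consequently, perfect-packing distributions are the worst case: $\inf_G \mathrm{AECR}(G)=\inf_F \mathrm{AECR}(F)$, where $G$ ranges over all nontrivial perfect-packing distributions and $F$ over all nontrivial discrete distributions. -/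

import Mathlib

namespace BinCovering

noncomputable section

open scoped Classical in
/-- The number of bins that Dual Next-Fit fills on the given list, when the currently open bin
already has level `ℓ`: each item goes into the open bin, and as soon as the level of that bin
is at least `1` the bin is counted as filled and a new, empty bin is opened. -/
def dnfFrom : ℝ → List ℝ → ℕ
  | _, [] => 0
  | ℓ, a :: L => if 1 ≤ ℓ + a then dnfFrom 0 L + 1 else dnfFrom (ℓ + a) L

/-- `DNF(L)`: the number of bins filled by Dual Next-Fit on the list `L`. -/
def dnf (L : List ℝ) : ℕ := dnfFrom 0 L

/-- `k` bins can be filled with items of `L`: there are `k` pairwise disjoint sets of positions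
of `L`, each containing items of total size at least `1`. -/
def CanFill (L : List ℝ) (k : ℕ) : Prop :=
  ∃ X : Fin k → Finset (Fin L.length),
    (∀ i j, i ≠ j → Disjoint (X i) (X j)) ∧ ∀ j, 1 ≤ ∑ i ∈ X j, L.get i

/-- `OPT(L)`: the maximal number of bins that can be filled with the items of `L`. -/
def opt (L : List ℝ) : ℕ := sSup {k | CanFill L k}

theorem CanFill.le_length {L : List ℝ} {k : ℕ} (h : CanFill L k) : k ≤ L.length := by
  obtain ⟨X, hd, hs⟩ := h
  have hne : ∀ j, (X j).Nonempty := by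
    intro j
    rw [Finset.nonempty_iff_ne_empty]
    intro h0
    have := hs j
    rw [h0] at this
    norm_num at this
  choose f hf using hne
  have hinj : Function.Injective f := by
    intro i j hij
    by_contra hne
    exact Finset.disjoint_left.mp (hd i j hne) (hf i) (hij ▸ hf j)
  simpa using Fintype.card_le_of_injective f hinj

/-- The maximum in the definition of `opt` is attained. -/
theorem isGreatest_opt (L : List ℝ) : IsGreatest {k | CanFill L k} (opt L) := by
  have hb : BddAbove {k | CanFill L k} := ⟨L.length, fun _ h => h.le_length⟩
  refine ⟨Nat.sSup_mem ⟨0, ?_⟩ hb, fun k hk => le_csSup hb hk⟩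
  exact ⟨fun j => j.elim0, fun i => i.elim0, fun j => j.elim0⟩

/-- `W^OPT(L) = s(L) - OPT(L)`: the waste of an optimal packing of the list `L`. -/
def wasteOpt (L : List ℝ) : ℝ := L.sum - (opt L : ℝ)

/-- The rearrangement `σ(L)` of the list `L`. -/
def permute (L : List ℝ) (σ : Equiv.Perm (Fin L.length)) : List ℝ :=
  List.ofFn fun i => L.get (σ i)

/-- `E_σ[A(σ(L))]` for a uniformly random permutation `σ` of the positions of `L`. -/
def randomOrderMean (A : List ℝ → ℕ) (L : List ℝ) : ℝ :=
  (∑ σ : Equiv.Perm (Fin L.length), (A (permute L σ) : ℝ)) / (L.length.factorial : ℝ)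

/-- A discrete distribution: finitely many non-negative rational item sizes with positive
rational probabilities that sum to `1`. -/
structure DiscreteDistribution where
  m : ℕ
  size : Fin m → ℚ
  prob : Fin m → ℚ
  size_nonneg : ∀ i, 0 ≤ size i
  prob_pos : ∀ i, 0 < prob i
  prob_sum : ∑ i, prob i = 1

namespace DiscreteDistribution

/-- `E[f(I_n(F))]`, where `I_n(F)` is a list of `n` items drawn i.i.d. according to `F`. -/
def expect (F : DiscreteDistribution) (n : ℕ) (f : List ℝ → ℝ) : ℝ :=
  ∑ ω : Fin n → Fin F.m,
    (∏ i, (F.prob (ω i) : ℝ)) * f (List.ofFn fun i => (F.size (ω i) : ℝ))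

/-- The perfect-packing property `E[W^OPT(I_n(F))] = o(n)`. -/
def IsPerfectPacking (F : DiscreteDistribution) : Prop :=
  Asymptotics.IsLittleO Filter.atTop (fun n : ℕ => F.expect n wasteOpt) (fun n : ℕ => (n : ℝ))

/-- `F` is not concentrated on items of size `0`. Exactly for these distributions
`E[OPT(I_n(F))]` is non-zero for some `n` (and then for all large `n`). -/
def IsNontrivial (F : DiscreteDistribution) : Prop := ∃ i, 0 < F.size i

/-- `E[A(I_n(F))] / E[OPT(I_n(F))]`. -/
def expectedRatio (A : List ℝ → ℕ) (F : DiscreteDistribution) (n : ℕ) : ℝ :=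
  F.expect n (fun L => (A L : ℝ)) / F.expect n (fun L => (opt L : ℝ))

/-- The asymptotic expected competitive ratio of the algorithm `A` for `F`. -/
def aecr (A : List ℝ → ℕ) (F : DiscreteDistribution) : ℝ :=
  Filter.liminf (fun n => expectedRatio A F n) Filter.atTop

/-- The asymptotic expected competitive ratio of `A` for a set of distributions. -/
def aecrSet (A : List ℝ → ℕ) (S : Set DiscreteDistribution) : ℝ :=
  sInf (aecr A '' S)

end DiscreteDistribution

end

end BinCovering

/-!
Shrinking items can only lose bins for Dual Next-Fit (`dnf_mono`): processing both lists in
parallel, the number of filled bins followed by the level of the open bin stays ordered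
lexicographically. Hence an input that is shrunk just enough to remove the waste of an optimal
packing, without changing its number of bins, is at least as bad for Dual Next-Fit.

For a list this is immediate: scale down the items of each bin of an optimal packing so that the
bin is exactly full, and shrink all other items to size `0`
(`exists_shrunk_wasteOpt_eq_zero`). The same works for every order of the items.

For a distribution the optimal packing is replaced by an optimal solution of the configuration
linear program, which packs filled bins of finitely many configurations `B` at rates `x B`, using
each item type at most at its probability. Its value `v` bounds the mean optimum per item from
above (`iidMean_opt_le`). To stay within the rational distributions, a rational optimal solution
is needed; its existence is derived from Gordan's lemma (`exists_optimal_packing`). An item is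
assigned at random to one of the configurations using its type, or to none, in agreement with the
rates, and shrunk accordingly. This couples the given distribution with a new one whose items are
smaller, have mean size `v`, and, because the numbers of occurrences of the types deviate from
their means by `O(√n)` (`iidMean_abs_count_sub_le`), fill `n * v - O(√n)` bins on average
(`le_iidMean_opt_shrunkSize`). So the new distribution is a perfect-packing one, its optimum per
item is at least the old one, and Dual Next-Fit fills at most as many bins on it. All the limits
exist by Fekete's lemma, as both `dnf` and `opt` are superadditive under concatenation.
-/

namespace BinCovering

/-! ### Dual Next-Fit: monotonicity and superadditivity -/

/-- Dual Next-Fit is monotone in the item sizes and in the initial level. The second inequality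
is what makes the induction work: as soon as the smaller list is a whole bin behind, it stays
behind, whatever the levels of the open bins are. -/
theorem dnfFrom_mono_aux {L' L : List ℝ} (h : List.Forall₂ (fun a' a => 0 ≤ a' ∧ a' ≤ a) L' L) :
    (∀ ℓ' ℓ : ℝ, ℓ' ≤ ℓ → dnfFrom ℓ' L' ≤ dnfFrom ℓ L) ∧
      ∀ ℓ' ℓ : ℝ, 0 ≤ ℓ → dnfFrom ℓ' L' ≤ dnfFrom ℓ L + 1 := by
  induction h with
  | nil => simp [dnfFrom]
  | @cons a' a L' L ha _ ih =>
    obtain ⟨ihA, ihB⟩ := ih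
    have h0 := ihA 0 0 le_rfl
    refine ⟨fun ℓ' ℓ hℓ => ?_, fun ℓ' ℓ hℓ => ?_⟩
    · simp only [dnfFrom]
      split_ifs with h1 h2 h2
      · omega
      · linarith
      · exact ihB _ _ le_rfl
      · exact ihA _ _ (by linarith)
    · simp only [dnfFrom]
      split_ifs with h1 h2 h2
      · omega
      · have := ihA 0 (ℓ + a) (by linarith)
        omega
      · have := ihB (ℓ' + a') 0 le_rfl
        omega
      · exact ihB _ _ (by linarith)

theorem dnf_mono {L' L : List ℝ} (h : List.Forall₂ (fun a' a => 0 ≤ a' ∧ a' ≤ a) L' L) :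
    dnf L' ≤ dnf L :=
  (dnfFrom_mono_aux h).1 0 0 le_rfl

theorem dnfFrom_mono_level {L : List ℝ} (hL : ∀ a ∈ L, 0 ≤ a) {ℓ' ℓ : ℝ} (h : ℓ' ≤ ℓ) :
    dnfFrom ℓ' L ≤ dnfFrom ℓ L :=
  (dnfFrom_mono_aux (List.forall₂_same.2 fun a ha => ⟨hL a ha, le_rfl⟩)).1 ℓ' ℓ h

theorem dnfFrom_append {L₁ L₂ : List ℝ} (h₁ : ∀ a ∈ L₁, 0 ≤ a) (h₂ : ∀ a ∈ L₂, 0 ≤ a)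
    {ℓ : ℝ} (hℓ : 0 ≤ ℓ) : dnfFrom ℓ L₁ + dnf L₂ ≤ dnfFrom ℓ (L₁ ++ L₂) := by
  induction L₁ generalizing ℓ with
  | nil => simpa [dnfFrom, dnf] using dnfFrom_mono_level h₂ hℓ
  | cons a L ih =>
    have ha := h₁ a (by simp)
    have hL : ∀ b ∈ L, 0 ≤ b := fun b hb => h₁ b (by simp [hb])
    simp only [List.cons_append, dnfFrom]
    split_ifs with h
    · have := ih hL le_rfl
      omega
    · exact ih hL (by linarith)

theorem dnf_append {L₁ L₂ : List ℝ} (h₁ : ∀ a ∈ L₁, 0 ≤ a) (h₂ : ∀ a ∈ L₂, 0 ≤ a) :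
    dnf L₁ + dnf L₂ ≤ dnf (L₁ ++ L₂) :=
  dnfFrom_append h₁ h₂ le_rfl

theorem dnfFrom_le_length (ℓ : ℝ) (L : List ℝ) : dnfFrom ℓ L ≤ L.length := by
  induction L generalizing ℓ with
  | nil => simp [dnfFrom]
  | cons a L ih =>
    simp only [dnfFrom, List.length_cons]
    split_ifs
    · exact Nat.succ_le_succ (ih _)
    · exact (ih _).trans (Nat.le_succ _)

/-! ### Optimal packings -/

theorem CanFill.le_opt {L : List ℝ} {k : ℕ} (h : CanFill L k) : k ≤ opt L :=
  (isGreatest_opt L).2 h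

theorem canFill_opt (L : List ℝ) : CanFill L (opt L) :=
  (isGreatest_opt L).1

theorem opt_le_length (L : List ℝ) : opt L ≤ L.length :=
  (canFill_opt L).le_length

theorem opt_le_sum {L : List ℝ} (hL : ∀ a ∈ L, 0 ≤ a) : (opt L : ℝ) ≤ L.sum := by
  obtain ⟨X, hd, hs⟩ := canFill_opt L
  calc (opt L : ℝ) = ∑ _j : Fin (opt L), (1 : ℝ) := by simp
    _ ≤ ∑ j, ∑ i ∈ X j, L.get i := Finset.sum_le_sum fun j _ => hs j
    _ = ∑ i ∈ Finset.univ.biUnion X, L.get i :=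
      (Finset.sum_biUnion fun i _ j _ hij => hd i j hij).symm
    _ ≤ ∑ i, L.get i :=
      Finset.sum_le_sum_of_subset_of_nonneg (Finset.subset_univ _)
        fun i _ _ => hL _ (List.get_mem L i)
    _ = L.sum := by
      conv_rhs => rw [← List.ofFn_get L, List.sum_ofFn]

theorem wasteOpt_nonneg {L : List ℝ} (hL : ∀ a ∈ L, 0 ≤ a) : 0 ≤ wasteOpt L :=
  sub_nonneg.2 (opt_le_sum hL)

theorem CanFill.of_embedding {L₁ L₂ : List ℝ} {k : ℕ} (e : Fin L₁.length ↪ Fin L₂.length)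
    (he : ∀ i, L₂.get (e i) = L₁.get i) (h : CanFill L₁ k) : CanFill L₂ k := by
  obtain ⟨X, hd, hs⟩ := h
  refine ⟨fun j => (X j).map e, fun i j hij => (Finset.disjoint_map e).2 (hd i j hij),
    fun j => ?_⟩
  simpa only [Finset.sum_map, he] using hs j

theorem CanFill.of_subperm {L₁ L₂ : List ℝ} {k : ℕ} (h : L₁.Subperm L₂) (hk : CanFill L₁ k) :
    CanFill L₂ k := by
  classical
  exact hk.of_embedding ⟨h.idxInj, h.idxInj_injective⟩ fun _ => h.getElem_idxInj_eq_getElem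

theorem CanFill.append {L₁ L₂ : List ℝ} {k₁ k₂ : ℕ} (h₁ : CanFill L₁ k₁) (h₂ : CanFill L₂ k₂) :
    CanFill (L₁ ++ L₂) (k₁ + k₂) := by
  obtain ⟨X, hXd, hXs⟩ := h₁
  obtain ⟨Y, hYd, hYs⟩ := h₂
  have hlen : L₁.length + L₂.length = (L₁ ++ L₂).length := by simp
  let e₁ : Fin L₁.length ↪ Fin (L₁ ++ L₂).length :=
    (Fin.castAddEmb L₂.length).trans (finCongr hlen).toEmbedding
  let e₂ : Fin L₂.length ↪ Fin (L₁ ++ L₂).length :=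
    (Fin.natAddEmb L₁.length).trans (finCongr hlen).toEmbedding
  have hdisj : ∀ (A : Finset (Fin L₁.length)) (B : Finset (Fin L₂.length)),
      Disjoint (A.map e₁) (B.map e₂) := by
    intro A B
    rw [Finset.disjoint_left]
    intro p hp hp'
    obtain ⟨a, -, rfl⟩ := Finset.mem_map.1 hp
    obtain ⟨b, -, hb⟩ := Finset.mem_map.1 hp'
    have := congrArg Fin.val hb
    simp [e₁, e₂] at this
    omega
  have hg₁ : ∀ i, (L₁ ++ L₂).get (e₁ i) = L₁.get i := fun i => by simp [e₁]
  have hg₂ : ∀ i, (L₁ ++ L₂).get (e₂ i) = L₂.get i := fun i => by simp [e₂]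
  refine ⟨Fin.append (fun j => (X j).map e₁) (fun j => (Y j).map e₂), fun i j hij => ?_,
    fun j => ?_⟩
  · induction i using Fin.addCases <;> induction j using Fin.addCases <;>
      simp only [Fin.append_left, Fin.append_right]
    · exact (Finset.disjoint_map e₁).2 (hXd _ _ fun h => hij (by rw [h]))
    · exact hdisj _ _
    · exact (hdisj _ _).symm
    · exact (Finset.disjoint_map e₂).2 (hYd _ _ fun h => hij (by rw [h]))
  · induction j using Fin.addCases <;>
      simp only [Fin.append_left, Fin.append_right, Finset.sum_map, hg₁, hg₂]
    · exact hXs _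
    · exact hYs _

theorem opt_append (L₁ L₂ : List ℝ) : opt L₁ + opt L₂ ≤ opt (L₁ ++ L₂) :=
  ((canFill_opt L₁).append (canFill_opt L₂)).le_opt

theorem canFill_zero (L : List ℝ) : CanFill L 0 :=
  ⟨fun j => j.elim0, fun i => i.elim0, fun j => j.elim0⟩

theorem canFill_one {L : List ℝ} (h : 1 ≤ L.sum) : CanFill L 1 := by
  refine ⟨fun _ => Finset.univ, fun i j hij => (hij (Subsingleton.elim i j)).elim, fun _ => ?_⟩
  rwa [← List.sum_ofFn, List.ofFn_get]

/-- If the items of a list contain, counted with multiplicity, the items of all the bins in `Bs`,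
then these bins can be filled simultaneously. Items are given by their types `τ : κ`, of
size `t τ`. -/
theorem canFill_of_sum_le {κ : Type*} (t : κ → ℝ) (Bs : Multiset (Multiset κ))
    (hB : ∀ b ∈ Bs, 1 ≤ (b.map t).sum) (T : List κ) (hT : Bs.sum ≤ (T : Multiset κ)) :
    CanFill (T.map t) Bs.card := by
  induction Bs using Multiset.induction_on generalizing T with
  | empty => exact canFill_zero _
  | cons b Bs ih =>
    rw [Multiset.sum_cons] at hT
    have h₁ : CanFill (b.toList.map t) 1 := canFill_one (by
      have := hB b (Multiset.mem_cons_self _ _)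
      rwa [← Multiset.sum_coe, ← Multiset.map_coe, Multiset.coe_toList])
    have h₂ := ih (fun c hc => hB c (Multiset.mem_cons_of_mem hc)) Bs.sum.toList (by simp)
    rw [Multiset.card_cons, add_comm]
    refine (h₁.append h₂).of_subperm ?_
    rw [← List.map_append, ← Multiset.coe_le, ← Multiset.map_coe, ← Multiset.map_coe]
    refine Multiset.map_le_map ?_
    rw [← Multiset.coe_add, Multiset.coe_toList, Multiset.coe_toList]
    exact hT

/-! ### Lists in random order -/

theorem randomOrderMean_eq (A : List ℝ → ℕ) {L : List ℝ} {n : ℕ} (h : L.length = n)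
    {f : Fin n → ℝ} (hf : L = List.ofFn f) :
    randomOrderMean A L =
      (∑ σ : Equiv.Perm (Fin n), (A (List.ofFn fun i => f (σ i)) : ℝ)) / (n.factorial : ℝ) := by
  have hget : f = fun i => L.get (i.cast h.symm) := by
    funext i
    simp [hf]
  clear hf
  subst hget
  subst h
  rfl

/-- Shrinking every item to make each bin of an optimal packing exactly full, with the items
outside the packing shrunk to size `0`, yields a list without waste and with the same optimum. -/
theorem exists_shrunk_wasteOpt_eq_zero (L : List ℝ) (hL : ∀ a ∈ L, 0 ≤ a) :
    ∃ f : Fin L.length → ℝ, (∀ i, 0 ≤ f i ∧ f i ≤ L.get i) ∧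
      opt (List.ofFn f) = opt L ∧ wasteOpt (List.ofFn f) = 0 := by
  classical
  obtain ⟨X, hd, hs⟩ := canFill_opt L
  have hnn : ∀ i, 0 ≤ L.get i := fun i => hL _ (List.get_mem L i)
  set S : Fin (opt L) → ℝ := fun j => ∑ i ∈ X j, L.get i
  have hS : ∀ j, 0 < S j := fun j => one_pos.trans_le (hs j)
  let f : Fin L.length → ℝ := fun i => ∑ j, if i ∈ X j then L.get i / S j else 0
  have hfX : ∀ j, ∀ i ∈ X j, f i = L.get i / S j := by
    intro j i hi
    refine (Finset.sum_eq_single j (fun j' _ hj' => ?_) (by simp)).trans (if_pos hi)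
    exact if_neg fun hi' => Finset.disjoint_left.1 (hd j' j hj') hi' hi
  have hf0 : ∀ i, (∀ j, i ∉ X j) → f i = 0 := fun i hi =>
    Finset.sum_eq_zero fun j _ => if_neg (hi j)
  have hf : ∀ i, 0 ≤ f i ∧ f i ≤ L.get i := by
    intro i
    by_cases h : ∃ j, i ∈ X j
    · obtain ⟨j, hj⟩ := h
      rw [hfX j i hj]
      exact ⟨div_nonneg (hnn i) (hS j).le, div_le_self (hnn i) (hs j)⟩
    · rw [hf0 i (not_exists.1 h)]
      exact ⟨le_rfl, hnn i⟩
  have hbin : ∀ j, ∑ i ∈ X j, f i = 1 := fun j => by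
    rw [Finset.sum_congr rfl (hfX j), ← Finset.sum_div, div_self (hS j).ne']
  have hsum : (List.ofFn f).sum = opt L := by
    rw [List.sum_ofFn]
    simp only [f]
    rw [Finset.sum_comm]
    calc ∑ j, ∑ i, (if i ∈ X j then L.get i / S j else 0)
        = ∑ j, ∑ i ∈ X j, f i := Finset.sum_congr rfl fun j _ => by
          rw [Finset.sum_congr rfl (hfX j), Finset.sum_ite_mem, Finset.univ_inter]
      _ = opt L := by simp [hbin]
  have hfill : CanFill (List.ofFn f) (opt L) := by
    let e : Fin L.length ↪ Fin (List.ofFn f).length :=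
      (finCongr (List.length_ofFn (f := f)).symm).toEmbedding
    refine ⟨fun j => (X j).map e, fun i j hij => (Finset.disjoint_map e).2 (hd i j hij),
      fun j => ?_⟩
    rw [Finset.sum_map, ← hbin j]
    exact (Finset.sum_congr rfl fun i _ => by simp [e]).le
  have hnn' : ∀ a ∈ List.ofFn f, 0 ≤ a := by
    intro a ha
    obtain ⟨i, rfl⟩ := List.mem_ofFn.1 ha
    exact (hf i).1
  have hopt : opt (List.ofFn f) = opt L := by
    refine le_antisymm ?_ hfill.le_opt
    have := opt_le_sum hnn'
    rw [hsum] at this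
    exact_mod_cast this
  exact ⟨f, hf, hopt, by rw [wasteOpt, hopt, hsum, sub_self]⟩

theorem exists_wasteOpt_eq_zero_ratio_le (L : List ℝ) (hL : ∀ a ∈ L, 0 ≤ a ∧ a ≤ 1)
    (hopt : 0 < opt L) :
    ∃ H : List ℝ, (∀ a ∈ H, 0 ≤ a ∧ a ≤ 1) ∧ 0 < opt H ∧ wasteOpt H = 0 ∧
      randomOrderMean dnf H / (opt H : ℝ) ≤ randomOrderMean dnf L / (opt L : ℝ) := by
  obtain ⟨f, hf, hfopt, hw⟩ := exists_shrunk_wasteOpt_eq_zero L fun a ha => (hL a ha).1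
  refine ⟨List.ofFn f, fun a ha => ?_, by omega, hw, ?_⟩
  · obtain ⟨i, rfl⟩ := List.mem_ofFn.1 ha
    exact ⟨(hf i).1, (hf i).2.trans (hL _ (List.get_mem L i)).2⟩
  · rw [hfopt, randomOrderMean_eq dnf (List.length_ofFn (f := f)) rfl,
      randomOrderMean_eq dnf rfl (List.ofFn_get L).symm]
    gcongr with σ
    refine dnf_mono (List.forall₂_iff_get.2 ⟨by simp, fun i h₁ h₂ => ?_⟩)
    simpa using hf (σ ⟨i, by simpa using h₁⟩)

/-! ### Expectations over i.i.d. lists -/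

/-- The mean of `f` over lists of `n` independent types, each drawn with the weights `q`. The
weights are not required to sum to `1`, and the scalars may be rational or real. -/
def iidMean {ι R : Type*} [Fintype ι] [Semiring R] (q : ι → R) : ℕ → (List ι → R) → R
  | 0, f => f []
  | n + 1, f => ∑ i, q i * iidMean q n fun T => f (i :: T)

theorem count_eq_sum_map {ι : Type*} [DecidableEq ι] (T : List ι) (i : ι) :
    T.count i = (T.map fun j => if j = i then 1 else 0).sum := by
  induction T with
  | nil => rfl
  | cons a T ih =>
    rw [List.count_cons, List.map_cons, List.sum_cons, ih, add_comm]
    simp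

section iidMean

variable {ι κ : Type*} [Fintype ι] [Fintype κ]

theorem iidMean_eq_sum {q : ι → ℝ} (n : ℕ) (f : List ι → ℝ) :
    iidMean q n f = ∑ ω : Fin n → ι, (∏ i, q (ω i)) * f (List.ofFn ω) := by
  induction n generalizing f with
  | zero => simp [iidMean]
  | succ n ih =>
    simp only [iidMean, ih]
    rw [← (Fin.consEquiv fun _ => ι).sum_comp, Fintype.sum_prod_type]
    refine Finset.sum_congr rfl fun i _ => ?_
    rw [Finset.mul_sum]
    refine Finset.sum_congr rfl fun ω _ => ?_
    simp [Fin.consEquiv, Fin.prod_univ_succ, List.ofFn_succ, mul_assoc]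

theorem expect_eq_iidMean (F : DiscreteDistribution) (n : ℕ) (f : List ℝ → ℝ) :
    F.expect n f = iidMean (fun i => (F.prob i : ℝ)) n
      fun T => f (T.map fun i => (F.size i : ℝ)) := by
  simp only [iidMean_eq_sum, DiscreteDistribution.expect, List.map_ofFn]
  rfl

section Semiring

variable {R : Type*} [CommSemiring R] {q : ι → R}

theorem iidMean_congr {n : ℕ} {f g : List ι → R}
    (h : ∀ T : List ι, T.length = n → f T = g T) : iidMean q n f = iidMean q n g := by
  induction n generalizing f g with
  | zero => exact h [] rfl
  | succ n ih =>
    exact Finset.sum_congr rfl fun i _ => by rw [ih fun T hT => h (i :: T) (by simp [hT])]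

theorem iidMean_add (n : ℕ) (f g : List ι → R) :
    iidMean q n (fun T => f T + g T) = iidMean q n f + iidMean q n g := by
  induction n generalizing f g with
  | zero => rfl
  | succ n ih => simp only [iidMean, ih, mul_add, Finset.sum_add_distrib]

theorem iidMean_mul_left (n : ℕ) (c : R) (f : List ι → R) :
    iidMean q n (fun T => c * f T) = c * iidMean q n f := by
  induction n generalizing f with
  | zero => rfl
  | succ n ih => simp only [iidMean, ih, Finset.mul_sum, mul_left_comm]

theorem iidMean_sum {α : Type*} (s : Finset α) (n : ℕ) (f : α → List ι → R) :
    iidMean q n (fun T => ∑ a ∈ s, f a T) = ∑ a ∈ s, iidMean q n (f a) := by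
  classical
  induction s using Finset.induction_on with
  | empty =>
    simpa using iidMean_mul_left (q := q) n 0 fun _ => 0
  | insert a s ha ih => simp only [Finset.sum_insert ha, iidMean_add, ih]

theorem iidMean_const (hq : ∑ i, q i = 1) (n : ℕ) (c : R) : iidMean q n (fun _ => c) = c := by
  induction n with
  | zero => rfl
  | succ n ih => simp only [iidMean, ih, ← Finset.sum_mul, hq, one_mul]

theorem iidMean_append (n m : ℕ) (f : List ι → R) :
    iidMean q (n + m) f = iidMean q n fun T => iidMean q m fun U => f (T ++ U) := by
  induction n generalizing f with
  | zero => simp [iidMean]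
  | succ n ih =>
    rw [Nat.add_right_comm]
    simp only [iidMean, ih, List.cons_append]

theorem iidMean_sum_map (hq : ∑ i, q i = 1) (t : ι → R) (n : ℕ) :
    iidMean q n (fun T => (T.map t).sum) = n * ∑ i, q i * t i := by
  induction n with
  | zero => simp [iidMean]
  | succ n ih =>
    simp only [iidMean, List.map_cons, List.sum_cons, iidMean_add, iidMean_const hq, ih, mul_add,
      Finset.sum_add_distrib, ← Finset.sum_mul, hq]
    push_cast
    ring

/-- Forgetting part of the information in a type does not change means: the weights are pushed
forward along `g`. -/
theorem iidMean_map {p : κ → R} (g : ι → κ) [DecidableEq κ]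
    (hp : ∀ k, p k = ∑ i with g i = k, q i) (n : ℕ) (f : List κ → R) :
    iidMean q n (fun T => f (T.map g)) = iidMean p n f := by
  induction n generalizing f with
  | zero => rfl
  | succ n ih =>
    simp only [iidMean, List.map_cons, hp, Finset.sum_mul]
    rw [← Finset.sum_fiberwise_of_maps_to (s := Finset.univ) (t := Finset.univ) (g := g)
      fun _ _ => Finset.mem_univ _]
    refine Finset.sum_congr rfl fun k _ => Finset.sum_congr rfl fun i hi => ?_
    rw [← (Finset.mem_filter.1 hi).2, ih fun T => f (g i :: T)]

end Semiring

theorem iidMean_ratCast (q : ι → ℚ) (n : ℕ) (f : List ι → ℚ) :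
    ((iidMean q n f : ℚ) : ℝ) = iidMean (fun i => (q i : ℝ)) n fun T => (f T : ℝ) := by
  induction n generalizing f with
  | zero => rfl
  | succ n ih => simp only [iidMean, Rat.cast_sum, Rat.cast_mul, ih]

section Ordered

variable {R : Type*} [Field R] [LinearOrder R] [IsStrictOrderedRing R] {q : ι → R}

theorem iidMean_mono (hq : ∀ i, 0 ≤ q i) {n : ℕ} {f g : List ι → R}
    (h : ∀ T : List ι, T.length = n → f T ≤ g T) : iidMean q n f ≤ iidMean q n g := by
  induction n generalizing f g with
  | zero => exact h [] rfl
  | succ n ih =>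
    exact Finset.sum_le_sum fun i _ =>
      mul_le_mul_of_nonneg_left (ih fun T hT => h (i :: T) (by simp [hT])) (hq i)

theorem iidMean_nonneg (hq : ∀ i, 0 ≤ q i) {n : ℕ} {f : List ι → R} (h : ∀ T, 0 ≤ f T) :
    0 ≤ iidMean q n f := by
  induction n generalizing f with
  | zero => exact h []
  | succ n ih => exact Finset.sum_nonneg fun i _ => mul_nonneg (hq i) (ih fun T => h _)

theorem pow_mul_le_iidMean (hq : ∀ i, 0 ≤ q i) (i : ι) (n : ℕ) {f : List ι → R}
    (h : ∀ T, 0 ≤ f T) : q i ^ n * f (List.replicate n i) ≤ iidMean q n f := by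
  induction n generalizing f with
  | zero => simp [iidMean]
  | succ n ih =>
    calc q i ^ (n + 1) * f (List.replicate (n + 1) i)
        = q i * (q i ^ n * f (i :: List.replicate n i)) := by
          rw [List.replicate_succ, pow_succ]; ring
      _ ≤ q i * iidMean q n fun T => f (i :: T) :=
          mul_le_mul_of_nonneg_left (ih (f := fun T => f (i :: T)) fun T => h _) (hq i)
      _ ≤ _ := Finset.single_le_sum
          (f := fun i => q i * iidMean q n fun T => f (i :: T))
          (fun j _ => mul_nonneg (hq j) (iidMean_nonneg hq fun T => h _)) (Finset.mem_univ i)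

end Ordered

variable [DecidableEq ι]

theorem iidMean_count {R : Type*} [CommSemiring R] {q : ι → R} (hq : ∑ i, q i = 1) (i : ι)
    (n : ℕ) : iidMean q n (fun T => (T.count i : R)) = n * q i := by
  have := iidMean_sum_map hq (fun j => if j = i then (1 : R) else 0) n
  simp only [mul_ite, mul_one, mul_zero, Finset.sum_ite_eq', Finset.mem_univ, if_true] at this
  rw [← this]
  congr 1
  funext T
  rw [count_eq_sum_map, Nat.cast_list_sum, List.map_map]
  congr 2
  funext j
  simp

/-- The second moment of the centred number of occurrences of `i`, shifted by `c`; the shift is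
what makes the induction on the number of items work. -/
theorem iidMean_sq_count_sub {q : ι → ℝ} (hq : ∑ i, q i = 1) (i : ι) (n : ℕ) (c : ℝ) :
    iidMean q n (fun T => (c + (T.count i - n * q i)) ^ 2) =
      c ^ 2 + n * (q i * (1 - q i)) := by
  induction n generalizing c with
  | zero => simp [iidMean]
  | succ n ih =>
    have hstep : ∀ j, (iidMean q n fun T =>
        (c + (((j :: T).count i : ℕ) - ((n + 1 : ℕ) : ℝ) * q i)) ^ 2) =
        (c + ((if j = i then 1 else 0) - q i)) ^ 2 + n * (q i * (1 - q i)) := by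
      intro j
      rw [← ih]
      congr 1
      funext T
      rw [List.count_cons]
      by_cases hj : j = i <;> simp [hj] <;> ring
    have hexp : ∀ j, q j * ((c + ((if j = i then 1 else 0) - q i)) ^ 2 + n * (q i * (1 - q i)))
        = q j * ((c - q i) ^ 2 + n * (q i * (1 - q i))) +
          (if j = i then q j * (2 * (c - q i) + 1) else 0) := by
      intro j
      split_ifs <;> ring
    simp only [iidMean, hstep, hexp, Finset.sum_add_distrib, ← Finset.sum_mul, hq,
      Finset.sum_ite_eq', Finset.mem_univ, if_true]
    push_cast
    ring

/-- The mean absolute deviation of the number of occurrences of `i` is at most `√n`. -/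
theorem iidMean_abs_count_sub_le {q : ι → ℝ} (hq0 : ∀ i, 0 ≤ q i) (hq : ∑ i, q i = 1) (i : ι)
    (n : ℕ) : iidMean q n (fun T => |(T.count i : ℝ) - n * q i|) ≤ √n := by
  rcases Nat.eq_zero_or_pos n with rfl | hn
  · simp [iidMean]
  have hs : 0 < √(n : ℝ) := Real.sqrt_pos.2 (by exact_mod_cast hn)
  have hss : √(n : ℝ) * √(n : ℝ) = n := Real.mul_self_sqrt (Nat.cast_nonneg n)
  -- the inequality of arithmetic and geometric means bounds `|x|` by a quadratic function
  have hamgm : ∀ x : ℝ, |x| ≤ (2 * √(n : ℝ))⁻¹ * x ^ 2 + √(n : ℝ) / 2 := by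
    intro x
    rw [← sub_nonneg, ← sq_abs x]
    have : (2 * √(n : ℝ))⁻¹ * |x| ^ 2 + √(n : ℝ) / 2 - |x| =
        (2 * √(n : ℝ))⁻¹ * (|x| - √(n : ℝ)) ^ 2 := by
      field_simp
      ring
    rw [this]
    positivity
  refine (iidMean_mono hq0 fun T _ => hamgm _).trans ?_
  rw [iidMean_add, iidMean_const hq, iidMean_mul_left]
  have hvar := iidMean_sq_count_sub hq i n 0
  simp only [zero_add] at hvar
  rw [hvar]
  have hq1 : q i * (1 - q i) ≤ 1 := by nlinarith [sq_nonneg (q i - 1 / 2)]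
  calc (2 * √(n : ℝ))⁻¹ * (0 ^ 2 + n * (q i * (1 - q i))) + √(n : ℝ) / 2
      ≤ (2 * √(n : ℝ))⁻¹ * (0 ^ 2 + n * 1) + √(n : ℝ) / 2 := by gcongr
    _ = √n := by
      rw [zero_pow two_ne_zero, zero_add, mul_one]
      nth_rewrite 2 [← hss]
      field_simp
      ring

end iidMean

/-! ### The configuration linear program has a rational optimum -/

theorem exists_common_denominator {α : Type*} [Fintype α] (r : α → ℚ) (hr : ∀ a, 0 ≤ r a) :
    ∃ D : ℕ, 0 < D ∧ ∃ R : α → ℕ, ∀ a, (R a : ℚ) = D * r a := by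
  classical
  refine ⟨∏ a, (r a).den, Finset.prod_pos fun a _ => (r a).den_pos,
    fun a => (∏ b ∈ Finset.univ.erase a, (r b).den) * (r a).num.toNat, fun a => ?_⟩
  rw [← Finset.mul_prod_erase Finset.univ _ (Finset.mem_univ a)]
  have h1 : (((r a).num.toNat : ℕ) : ℚ) = (r a).num := by
    exact_mod_cast congrArg (Int.cast : ℤ → ℚ) (Int.toNat_of_nonneg (Rat.num_nonneg.2 (hr a)))
  have h2 : ((r a).num : ℚ) = (r a).den * r a := by
    rw [mul_comm]; exact (Rat.mul_den_eq_num (r a)).symm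
  push_cast
  rw [h1, h2]
  ring

/-- A packing linear program with natural-number columns `A B ≠ 0` and rational right-hand side
`p ≥ 0` has a rational optimal solution. Multiples of feasible points, together with their slacks
and the multiplier `N`, form a submonoid of a power of `ℕ`; by Gordan's lemma it has finitely many
generators, and the generator with the largest ratio of value to multiplier is optimal. -/
theorem exists_optimal_packing {C ι : Type*} [Fintype C] [Fintype ι] (A : C → ι → ℕ)
    (hA : ∀ B, ∃ i, A B i ≠ 0) (p : ι → ℚ) (hp : ∀ i, 0 ≤ p i) :
    ∃ x : C → ℚ, (∀ B, 0 ≤ x B) ∧ (∀ i, ∑ B, x B * A B i ≤ p i) ∧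
      ∀ y : C → ℚ, (∀ B, 0 ≤ y B) → (∀ i, ∑ B, y B * A B i ≤ p i) → ∑ B, y B ≤ ∑ B, x B := by
  classical
  obtain ⟨D, hD, P, hP⟩ := exists_common_denominator p hp
  have hDQ : (0 : ℚ) < D := by exact_mod_cast hD
  -- a triple consists of integral rates, slacks and a multiplier; `φ = ψ` are the constraints
  let φ : (C → ℕ) × (ι → ℕ) × ℕ →+ (ι → ℕ) :=
    { toFun := fun z i => ∑ B, z.1 B * A B i + z.2.1 i
      map_zero' := by ext; simp
      map_add' := fun z w => by
        ext i
        simp only [Prod.fst_add, Prod.snd_add, Pi.add_apply, add_mul, Finset.sum_add_distrib]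
        ring }
  let ψ : (C → ℕ) × (ι → ℕ) × ℕ →+ (ι → ℕ) :=
    { toFun := fun z i => z.2.2 * P i
      map_zero' := by ext; simp
      map_add' := fun z w => by
        ext i
        simp only [Prod.snd_add, Pi.add_apply, add_mul] }
  obtain ⟨S, hS⟩ := AddSubmonoid.fg_eqLocusM φ ψ
  have hmem : ∀ z, z ∈ AddSubmonoid.closure (S : Set ((C → ℕ) × (ι → ℕ) × ℕ)) ↔
      ∀ i, ∑ B, z.1 B * A B i + z.2.1 i = z.2.2 * P i := by
    intro z
    rw [hS, AddMonoidHom.mem_eqLocusM]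
    exact funext_iff
  -- columns are non-zero, so multiplier `0` forces value `0`, and ratios to the multiplier suffice
  have hzero : ∀ z ∈ AddSubmonoid.closure (S : Set ((C → ℕ) × (ι → ℕ) × ℕ)), z.2.2 = 0 →
      ∀ B, z.1 B = 0 := by
    intro z hz h0 B
    obtain ⟨i, hi⟩ := hA B
    have h := (hmem z).1 hz i
    rw [h0, zero_mul] at h
    have h' := (Finset.sum_eq_zero_iff.1 (Nat.add_eq_zero_iff.1 h).1) B (Finset.mem_univ B)
    exact (Nat.mul_eq_zero.1 h').resolve_right hi
  -- the zero solution is added to the generators to have one with a positive multiplier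
  let S' := (insert ((0, P, 1) : (C → ℕ) × (ι → ℕ) × ℕ) S).filter fun z => 0 < z.2.2
  have hS'ne : S'.Nonempty := ⟨(0, P, 1), by simp [S']⟩
  have hS'mem : ∀ z ∈ S', z ∈ AddSubmonoid.closure (S : Set ((C → ℕ) × (ι → ℕ) × ℕ)) := by
    intro z hz
    rcases Finset.mem_insert.1 (Finset.mem_filter.1 hz).1 with rfl | h
    · rw [hmem]; simp
    · exact AddSubmonoid.subset_closure h
  let val : (C → ℕ) × (ι → ℕ) × ℕ → ℚ := fun z => ∑ B, (z.1 B : ℚ)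
  obtain ⟨z, hzS', hz⟩ := S'.exists_max_image (fun z => val z / z.2.2) hS'ne
  have hN : (0 : ℚ) < z.2.2 := by exact_mod_cast (Finset.mem_filter.1 hzS').2
  have hmax : ∀ w ∈ AddSubmonoid.closure (S : Set ((C → ℕ) × (ι → ℕ) × ℕ)),
      val w ≤ val z / z.2.2 * w.2.2 := by
    intro w hw
    induction hw using AddSubmonoid.closure_induction with
    | mem w hw =>
      rcases Nat.eq_zero_or_pos w.2.2 with h0 | hpos
      · have := hzero w (AddSubmonoid.subset_closure hw) h0
        simp [val, this, h0]
      · rw [← div_le_iff₀ (by exact_mod_cast hpos)]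
        exact hz w (Finset.mem_filter.2 ⟨Finset.mem_insert_of_mem hw, hpos⟩)
    | zero => simp [val]
    | add u w _ _ hu hw =>
      have : val (u + w) = val u + val w := by simp [val, Finset.sum_add_distrib]
      rw [this, Prod.snd_add, Prod.snd_add, Nat.cast_add, mul_add]
      exact add_le_add hu hw
  have hND : (0 : ℚ) < z.2.2 * D := mul_pos hN hDQ
  refine ⟨fun B => z.1 B / (z.2.2 * D), fun B => by positivity, fun i => ?_, fun y hy0 hy => ?_⟩
  · have h := (hmem z).1 (hS'mem z hzS') i
    have h' : ∑ B, (z.1 B : ℚ) * A B i ≤ z.2.2 * P i := by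
      exact_mod_cast (Nat.le_add_right _ _).trans h.le
    rw [hP] at h'
    simp only [div_mul_eq_mul_div]
    rw [← Finset.sum_div, div_le_iff₀ hND]
    linarith
  · obtain ⟨E, hE, Y, hY⟩ := exists_common_denominator y hy0
    have hEQ : (0 : ℚ) < E := by exact_mod_cast hE
    -- the multiple `D * E` of `y` is integral, and it is feasible with multiplier `E`
    have hle : ∀ i, ∑ B, (D * Y B) * A B i ≤ E * P i := by
      intro i
      have : (∑ B, ((D : ℚ) * Y B) * A B i) ≤ E * P i := by
        have h1 : (∑ B, ((D : ℚ) * Y B) * A B i) = E * (D * ∑ B, y B * A B i) := by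
          simp only [Finset.mul_sum]
          exact Finset.sum_congr rfl fun B _ => by rw [hY]; ring
        rw [h1, hP]
        exact mul_le_mul_of_nonneg_left (mul_le_mul_of_nonneg_left (hy i) hDQ.le) hEQ.le
      exact_mod_cast this
    have h := hmax (fun B => D * Y B, fun i => E * P i - ∑ B, (D * Y B) * A B i, E)
      ((hmem _).2 fun i => Nat.add_sub_cancel' (hle i))
    have hval : (∑ B, ((D * Y B : ℕ) : ℚ)) = D * E * ∑ B, y B := by
      rw [Finset.mul_sum]
      exact Finset.sum_congr rfl fun B _ => by push_cast; rw [hY]; ring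
    simp only [val, hval] at h
    rw [← Finset.sum_div, le_div_iff₀ hND]
    rw [div_mul_eq_mul_div, le_div_iff₀ hN] at h
    refine le_of_mul_le_mul_right ?_ hEQ
    linarith

/-! ### Limits of mean values per item -/

namespace DiscreteDistribution

theorem expect_nonneg (F : DiscreteDistribution) (n : ℕ) {f : List ℝ → ℝ} (hf : ∀ L, 0 ≤ f L) :
    0 ≤ F.expect n f := by
  rw [expect_eq_iidMean]
  exact iidMean_nonneg (fun i => by exact_mod_cast (F.prob_pos i).le) fun T => hf _

theorem sum_prob_cast (F : DiscreteDistribution) : ∑ i, (F.prob i : ℝ) = 1 := by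
  exact_mod_cast F.prob_sum

theorem prob_cast_nonneg (F : DiscreteDistribution) (i : Fin F.m) : (0 : ℝ) ≤ F.prob i := by
  exact_mod_cast (F.prob_pos i).le

theorem map_size_nonneg (F : DiscreteDistribution) (T : List (Fin F.m)) :
    ∀ a ∈ T.map fun i => (F.size i : ℝ), 0 ≤ a := by
  intro a ha
  obtain ⟨i, -, rfl⟩ := List.mem_map.1 ha
  exact_mod_cast F.size_nonneg i

/-- Means of superadditive functions of i.i.d. lists form a superadditive sequence, so that by
Fekete's lemma the mean per item converges to its supremum. -/
theorem exists_tendsto_expect_div (F : DiscreteDistribution) (f : List ℝ → ℕ)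
    (hlen : ∀ L, f L ≤ L.length)
    (happ : ∀ L₁ L₂ : List ℝ, (∀ a ∈ L₁, 0 ≤ a) → (∀ a ∈ L₂, 0 ≤ a) →
      f L₁ + f L₂ ≤ f (L₁ ++ L₂)) :
    ∃ l : ℝ, Filter.Tendsto (fun n : ℕ => F.expect n (fun L => (f L : ℝ)) / n) Filter.atTop
        (nhds l) ∧
      ∀ n : ℕ, n ≠ 0 → F.expect n (fun L => (f L : ℝ)) / n ≤ l := by
  set E : ℕ → ℝ := fun n => F.expect n fun L => (f L : ℝ)
  have hE : ∀ n, E n ≤ n := by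
    intro n
    simp only [E, expect_eq_iidMean]
    refine (iidMean_mono F.prob_cast_nonneg fun T hT => ?_).trans
      (iidMean_const F.sum_prob_cast n (n : ℝ)).le
    exact_mod_cast (hlen _).trans (by simp [hT])
  have hsub : Subadditive fun n => -E n := by
    intro n m
    simp only [E, expect_eq_iidMean, iidMean_append]
    have h1 : ∀ T : List (Fin F.m), iidMean (fun i => (F.prob i : ℝ)) m
        (fun U => (f (T.map fun i => (F.size i : ℝ)) : ℝ) + f (U.map fun i => (F.size i : ℝ))) =
        f (T.map fun i => (F.size i : ℝ)) + E m := by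
      intro T
      rw [iidMean_add, iidMean_const F.sum_prob_cast]
      simp only [E, expect_eq_iidMean]
    have h2 := iidMean_add (q := fun i => (F.prob i : ℝ)) n
      (fun T => (f (T.map fun i => (F.size i : ℝ)) : ℝ)) fun _ => E m
    rw [iidMean_const F.sum_prob_cast] at h2
    simp only [E, expect_eq_iidMean] at h1 h2
    rw [← neg_add, neg_le_neg_iff, ← h2]
    refine iidMean_mono F.prob_cast_nonneg fun T _ => ?_
    rw [← h1]
    refine iidMean_mono F.prob_cast_nonneg fun U _ => ?_
    rw [List.map_append]
    exact_mod_cast happ _ _ (F.map_size_nonneg T) (F.map_size_nonneg U)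
  have hbdd : BddBelow (Set.range fun n : ℕ => -E n / n) := by
    refine ⟨-1, ?_⟩
    rintro _ ⟨n, rfl⟩
    change -1 ≤ -E n / n
    rw [neg_div, neg_le_neg_iff]
    exact div_le_one_of_le₀ (hE n) (Nat.cast_nonneg n)
  refine ⟨-hsub.lim, ?_, fun n hn => ?_⟩
  · have := (hsub.tendsto_lim hbdd).neg
    simpa only [neg_div, neg_neg] using this
  · have := hsub.lim_le_div hbdd hn
    rw [neg_div] at this
    linarith

theorem exists_tendsto_expect_dnf_div (F : DiscreteDistribution) :
    ∃ l : ℝ, Filter.Tendsto (fun n : ℕ => F.expect n (fun L => (dnf L : ℝ)) / n) Filter.atTop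
      (nhds l) := by
  obtain ⟨l, hl, -⟩ := F.exists_tendsto_expect_div dnf (dnfFrom_le_length 0) fun _ _ => dnf_append
  exact ⟨l, hl⟩

theorem exists_tendsto_expect_opt_div (F : DiscreteDistribution) (hF : F.IsNontrivial) :
    ∃ l : ℝ, 0 < l ∧ Filter.Tendsto (fun n : ℕ => F.expect n (fun L => (opt L : ℝ)) / n)
      Filter.atTop (nhds l) := by
  obtain ⟨l, hl, hsup⟩ := F.exists_tendsto_expect_div opt opt_le_length
    fun L₁ L₂ _ _ => opt_append L₁ L₂
  refine ⟨l, ?_, hl⟩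
  -- for `n` large enough, `n` copies of an item of positive size fill a bin
  obtain ⟨i, hi⟩ := hF
  have hi' : (0 : ℝ) < F.size i := by exact_mod_cast hi
  obtain ⟨n, hn⟩ := exists_nat_ge ((1 : ℝ) / F.size i)
  have hn0 : (0 : ℝ) < n := (div_pos one_pos hi').trans_le hn
  rw [div_le_iff₀ hi'] at hn
  have hopt : 1 ≤ opt ((List.replicate n i).map fun i => (F.size i : ℝ)) := by
    refine (canFill_one ?_).le_opt
    simpa using hn
  have hpos : 0 < F.expect n fun L => (opt L : ℝ) := by
    rw [expect_eq_iidMean]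
    refine lt_of_lt_of_le ?_ (pow_mul_le_iidMean F.prob_cast_nonneg i n fun T => Nat.cast_nonneg _)
    refine mul_pos (pow_pos (by exact_mod_cast F.prob_pos i) n) ?_
    exact_mod_cast hopt
  exact (div_pos hpos hn0).trans_le (hsup n (by rintro rfl; simp at hn0))

theorem tendsto_expectedRatio {F : DiscreteDistribution} {A : List ℝ → ℕ} {d o : ℝ}
    (hd : Filter.Tendsto (fun n : ℕ => F.expect n (fun L => (A L : ℝ)) / n) Filter.atTop (nhds d))
    (ho : Filter.Tendsto (fun n : ℕ => F.expect n (fun L => (opt L : ℝ)) / n) Filter.atTop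
      (nhds o)) (ho0 : 0 < o) :
    Filter.Tendsto (fun n => expectedRatio A F n) Filter.atTop (nhds (d / o)) := by
  refine (hd.div ho ho0.ne').congr' ?_
  filter_upwards [Filter.eventually_ne_atTop 0] with n hn
  exact div_div_div_cancel_right₀ (Nat.cast_ne_zero.2 hn) _ _

/-- Any finite family of types with rational weights, some of which may vanish, gives rise to a
discrete distribution, by discarding the types of weight `0`. -/
theorem exists_of_weights {κ : Type*} [Fintype κ] (q t : κ → ℚ) (hq : ∀ τ, 0 ≤ q τ)
    (hq1 : ∑ τ, q τ = 1) (ht : ∀ τ, 0 ≤ t τ) :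
    ∃ G : DiscreteDistribution,
      (∀ n f, G.expect n f = iidMean (fun τ => (q τ : ℝ)) n fun T =>
        f (T.map fun τ => (t τ : ℝ))) ∧
      ((∃ τ, 0 < q τ ∧ 0 < t τ) → G.IsNontrivial) := by
  classical
  let e := (Fintype.equivFin {τ : κ // 0 < q τ}).symm
  have hsum : ∀ g : κ → ℚ, (∀ τ, q τ = 0 → g τ = 0) → ∑ k, g (e k) = ∑ τ, g τ := by
    intro g hg
    rw [e.sum_comp fun τ : {τ : κ // 0 < q τ} => g τ,
      ← Finset.sum_subtype (Finset.univ.filter fun τ => 0 < q τ) (by simp) g]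
    exact Finset.sum_filter_of_ne fun τ _ h => (hq τ).lt_of_ne fun h0 => h (hg τ h0.symm)
  let G : DiscreteDistribution :=
    { m := Fintype.card {τ : κ // 0 < q τ}
      size := fun k => t (e k)
      prob := fun k => q (e k)
      size_nonneg := fun k => ht _
      prob_pos := fun k => (e k).2
      prob_sum := by rw [hsum q fun _ h => h, hq1] }
  refine ⟨G, fun n f => ?_, ?_⟩
  · rw [expect_eq_iidMean, ← iidMean_map (q := fun k => (G.prob k : ℝ)) (fun k => (e k : κ))]
    · simp only [List.map_map]
      rfl
    · intro τ
      have := hsum (fun τ' => if τ' = τ then q τ' else 0) (by intro τ' h; simp [h])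
      rw [Finset.sum_ite_eq' Finset.univ τ, if_pos (Finset.mem_univ _)] at this
      rw [← this, Finset.sum_filter, Rat.cast_sum]
      refine Finset.sum_congr rfl fun k _ => ?_
      split_ifs <;> simp [G]
  · rintro ⟨τ, hτ, hτ'⟩
    exact ⟨e.symm ⟨τ, hτ⟩, by simpa [G] using hτ'⟩

end DiscreteDistribution

/-! ### Configurations -/

/-- A configuration for the item sizes `s` is a content of a filled bin: a multiplicity for each
item type, such that the total size is at least `1`. Multiplicities are capped at `K`. -/
abbrev Config {ι : Type*} [Fintype ι] (s : ι → ℚ) (K : ℕ) : Type _ :=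
  {B : ι → Fin (K + 1) // 1 ≤ ∑ i, ((B i : ℕ) : ℚ) * s i}

section Config

variable {ι : Type*} [Fintype ι] [DecidableEq ι] {s : ι → ℚ} {K : ℕ}

/-- The bins of an optimal packing, sorted by configuration. Capping the multiplicities at `K`
does not spoil a bin, since `K` items of any single positive size fill a bin on their own. -/
theorem exists_config_counts (hs : ∀ i, 0 ≤ s i) (hK : ∀ i, 0 < s i → 1 ≤ K * s i)
    (T : List ι) :
    ∃ y : Config s K → ℕ, ∑ B, y B = opt (T.map fun i => (s i : ℝ)) ∧
      ∀ i, ∑ B, y B * (B.1 i : ℕ) ≤ T.count i := by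
  obtain ⟨k, hk⟩ : ∃ k, k = opt (T.map fun i => (s i : ℝ)) := ⟨_, rfl⟩
  rw [← hk]
  obtain ⟨X, hd, hX⟩ := hk ▸ canFill_opt (T.map fun i => (s i : ℝ))
  let type : Fin (T.map fun i => (s i : ℝ)).length → ι := fun p => T.get (p.cast (by simp))
  have hget : ∀ p, (T.map fun i => (s i : ℝ)).get p = s (type p) := fun p => by simp [type]
  let c : Fin k → ι → ℕ := fun j i => ((X j).filter fun p => type p = i).card
  have hc : ∀ j, (1 : ℚ) ≤ ∑ i, (c j i : ℚ) * s i := by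
    intro j
    have h := hX j
    simp only [hget] at h
    have h' : (1 : ℚ) ≤ ∑ p ∈ X j, s (type p) := by exact_mod_cast h
    refine h'.trans_eq ?_
    rw [← Finset.sum_fiberwise_of_maps_to (s := X j) (t := Finset.univ) (g := type)
      fun _ _ => Finset.mem_univ _]
    refine Finset.sum_congr rfl fun i _ => ?_
    rw [Finset.sum_congr rfl fun p hp => by rw [(Finset.mem_filter.1 hp).2], Finset.sum_const,
      nsmul_eq_mul]
  let B : Fin k → Config s K := fun j => ⟨fun i => ⟨min K (c j i), by omega⟩, by
    by_cases h : ∃ i, 0 < s i ∧ K ≤ c j i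
    · obtain ⟨i, hi, hic⟩ := h
      refine (hK i hi).trans ?_
      have : ((K : ℕ) : ℚ) * s i = ((min K (c j i) : ℕ) : ℚ) * s i := by rw [min_eq_left hic]
      rw [this]
      exact Finset.single_le_sum (f := fun i => ((min K (c j i) : ℕ) : ℚ) * s i)
        (fun i _ => mul_nonneg (Nat.cast_nonneg _) (hs i)) (Finset.mem_univ i)
    · push Not at h
      refine (hc j).trans_eq (Finset.sum_congr rfl fun i _ => ?_)
      rcases (hs i).eq_or_lt with h0 | h0
      · simp [← h0]
      · simp only [min_eq_right (h i h0).le]⟩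
  refine ⟨fun C => (Finset.univ.filter fun j => B j = C).card, ?_, fun i => ?_⟩
  · rw [← Finset.card_eq_sum_card_fiberwise fun _ _ => Finset.mem_coe.2 (Finset.mem_univ _)]
    simp
  · calc ∑ C : Config s K, (Finset.univ.filter fun j => B j = C).card * (C.1 i : ℕ)
        = ∑ j, ((B j).1 i : ℕ) := by
          rw [← Finset.sum_fiberwise_of_maps_to (s := Finset.univ) (t := Finset.univ) (g := B)
            fun _ _ => Finset.mem_univ _]
          refine Finset.sum_congr rfl fun C _ => ?_
          rw [Finset.sum_congr rfl fun j hj => by rw [(Finset.mem_filter.1 hj).2],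
            Finset.sum_const, smul_eq_mul]
      _ ≤ ∑ j, c j i := Finset.sum_le_sum fun j _ => min_le_right _ _
      _ = (Finset.univ.biUnion fun j => (X j).filter fun p => type p = i).card :=
          (Finset.card_biUnion fun a _ b _ hab =>
            Finset.disjoint_filter_filter (hd a b hab)).symm
      _ ≤ (Finset.univ.filter fun p => type p = i).card :=
          Finset.card_le_card fun p hp => by
            obtain ⟨j, -, hj⟩ := Finset.mem_biUnion.1 hp
            exact Finset.mem_filter.2 ⟨Finset.mem_univ _, (Finset.mem_filter.1 hj).2⟩
      _ = T.count i := by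
          rw [Finset.card_filter, count_eq_sum_map, ← Fin.sum_univ_fun_getElem]
          exact (finCongr (by simp)).sum_comp fun p : Fin T.length => if T[p.1] = i then 1 else 0

/-- The value of an optimal solution of the configuration linear program bounds the mean number of
bins per item: the mean numbers of bins of each configuration are a feasible solution. -/
theorem iidMean_opt_le (hs : ∀ i, 0 ≤ s i) (hK : ∀ i, 0 < s i → 1 ≤ K * s i) {p : ι → ℚ}
    (hp : ∀ i, 0 ≤ p i) (hp1 : ∑ i, p i = 1) {v : ℚ}
    (hv : ∀ y : Config s K → ℚ, (∀ B, 0 ≤ y B) → (∀ i, ∑ B, y B * (B.1 i : ℕ) ≤ p i) →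
      ∑ B, y B ≤ v) (n : ℕ) :
    iidMean (fun i => (p i : ℝ)) n (fun T => (opt (T.map fun i => (s i : ℝ)) : ℝ)) ≤ n * v := by
  choose y hysum hycount using exists_config_counts (K := K) hs hK
  rcases Nat.eq_zero_or_pos n with rfl | hn
  · have h0 := opt_le_length []
    simp only [List.length_nil, Nat.le_zero] at h0
    simp [iidMean, h0]
  have hnQ : (0 : ℚ) < n := by exact_mod_cast hn
  have h := hv (fun B => iidMean p n (fun T => (y T B : ℚ)) / n)
    (fun B => div_nonneg (iidMean_nonneg hp fun T => Nat.cast_nonneg _) hnQ.le) fun i => by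
      simp only [div_mul_eq_mul_div]
      rw [← Finset.sum_div, div_le_iff₀ hnQ, mul_comm (p i), ← iidMean_count hp1]
      have : ∑ B : Config s K, iidMean p n (fun T => (y T B : ℚ)) * ((B.1 i : ℕ) : ℚ) =
          iidMean p n fun T => ∑ B : Config s K, ((B.1 i : ℕ) : ℚ) * (y T B : ℚ) := by
        rw [iidMean_sum]
        exact Finset.sum_congr rfl fun B _ => by rw [iidMean_mul_left, mul_comm]
      rw [this]
      refine iidMean_mono hp fun T _ => ?_
      simp only [mul_comm _ (y T _ : ℚ)]
      exact_mod_cast hycount T i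
  rw [← Finset.sum_div, div_le_iff₀ hnQ, ← iidMean_sum, mul_comm] at h
  have h' : ((iidMean p n fun T => ∑ B, (y T B : ℚ) : ℚ) : ℝ) ≤ n * v := by exact_mod_cast h
  rw [iidMean_ratCast] at h'
  refine le_trans (le_of_eq ?_) h'
  congr 1
  funext T
  rw [← hysum T]
  push_cast
  rfl

end Config

/-! ### Shrinking a distribution to a perfect-packing one -/

section Shrunk

variable {ι : Type*} [Fintype ι] {s : ι → ℚ} {K : ℕ}

/-- Items are shrunk in proportion to make each configuration exactly full; unused items are
shrunk to size `0`. -/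
def shrunkSize (s : ι → ℚ) (K : ℕ) : ι × Option (Config s K) → ℚ
  | (_, none) => 0
  | (i, some B) => s i / ∑ j, ((B.1 j : ℕ) : ℚ) * s j

theorem shrunkSize_nonneg (hs : ∀ i, 0 ≤ s i) (τ : ι × Option (Config s K)) :
    0 ≤ shrunkSize s K τ := by
  obtain ⟨i, _ | B⟩ := τ
  · exact le_rfl
  · exact div_nonneg (hs i) (zero_le_one.trans B.2)

theorem shrunkSize_le (hs : ∀ i, 0 ≤ s i) (τ : ι × Option (Config s K)) :
    shrunkSize s K τ ≤ s τ.1 := by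
  obtain ⟨i, _ | B⟩ := τ
  · exact hs i
  · exact div_le_self (hs i) B.2

theorem sum_mul_shrunkSize (B : Config s K) :
    ∑ i, ((B.1 i : ℕ) : ℚ) * shrunkSize s K (i, some B) = 1 := by
  simp only [shrunkSize, mul_div_assoc']
  rw [← Finset.sum_div, div_self (one_pos.trans_le B.2).ne']

variable [DecidableEq ι]

/-- The distribution of pairs of an item type and the configuration that an item of this type is
used in, or `none` if it is not used, when configuration `B` is packed at the rate `x B`. -/
def refinedWeight (p : ι → ℚ) (x : Config s K → ℚ) : ι × Option (Config s K) → ℚ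
  | (i, none) => p i - ∑ B, x B * (B.1 i : ℕ)
  | (i, some B) => x B * (B.1 i : ℕ)

theorem refinedWeight_nonneg {p : ι → ℚ} {x : Config s K → ℚ} (hx0 : ∀ B, 0 ≤ x B)
    (hx : ∀ i, ∑ B, x B * (B.1 i : ℕ) ≤ p i) (τ : ι × Option (Config s K)) :
    0 ≤ refinedWeight p x τ := by
  obtain ⟨i, _ | B⟩ := τ
  · exact sub_nonneg.2 (hx i)
  · exact mul_nonneg (hx0 B) (Nat.cast_nonneg _)

theorem sum_refinedWeight_fst (p : ι → ℚ) (x : Config s K → ℚ) (i : ι) :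
    ∑ o, refinedWeight p x (i, o) = p i := by
  simp [Fintype.sum_option, refinedWeight]

theorem sum_refinedWeight (p : ι → ℚ) (x : Config s K → ℚ) :
    ∑ τ, refinedWeight p x τ = ∑ i, p i := by
  simp only [Fintype.sum_prod_type, sum_refinedWeight_fst]

theorem sum_refinedWeight_mul_shrunkSize (p : ι → ℚ) (x : Config s K → ℚ) :
    ∑ τ, refinedWeight p x τ * shrunkSize s K τ = ∑ B, x B := by
  simp only [Fintype.sum_prod_type, Fintype.sum_option, refinedWeight]
  have h : ∀ i, shrunkSize s K (i, none) = 0 := fun _ => rfl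
  simp only [h, mul_zero, zero_add]
  rw [Finset.sum_comm]
  refine Finset.sum_congr rfl fun B _ => ?_
  simp only [mul_assoc]
  rw [← Finset.mul_sum, sum_mul_shrunkSize, mul_one]

/-- If the refined types occur about as often as expected, then almost `n * x B` bins of each
configuration `B` can be filled with the shrunk items. -/
theorem le_opt_map_shrunkSize (p : ι → ℚ) (x : Config s K → ℚ) (n : ℕ)
    (T : List (ι × Option (Config s K))) :
    n * ∑ B, (x B : ℝ) - Fintype.card (Config s K) *
      (∑ τ, |((T : Multiset _).count τ : ℝ) - n * (refinedWeight p x τ : ℝ)| + 1) ≤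
      opt (T.map fun τ => (shrunkSize s K τ : ℝ)) := by
  set Δ : ℝ := ∑ τ, |((T : Multiset _).count τ : ℝ) - n * (refinedWeight p x τ : ℝ)|
  -- giving up `Δ` bins of each configuration frees at least `Δ` items of each type used in it,
  -- which makes up for any shortage of this type
  let k : Config s K → ℕ := fun B => ⌊n * (x B : ℝ) - Δ⌋₊
  let b : Config s K → Multiset (ι × Option (Config s K)) := fun B =>
    ∑ i, (B.1 i : ℕ) • {(i, some B)}
  have hb : ∀ B, ((b B).map fun τ => (shrunkSize s K τ : ℝ)).sum = 1 := by
    intro B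
    have h := sum_mul_shrunkSize B
    rw [← Multiset.coe_mapAddMonoidHom]
    simp only [b, map_sum, map_nsmul, Multiset.coe_mapAddMonoidHom, Multiset.sum_sum,
      Multiset.sum_nsmul, Multiset.map_singleton, Multiset.sum_singleton, nsmul_eq_mul]
    exact_mod_cast h
  have hcount : ∀ B B' i, (b B).count (i, some B') = if B = B' then (B.1 i : ℕ) else 0 := by
    intro B B' i
    simp only [b, Multiset.count_sum', Multiset.count_nsmul, Multiset.count_singleton,
      Prod.mk.injEq, Option.some.injEq]
    by_cases h : B = B'
    · simp [h]
    · simp [h, Ne.symm h]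
  have hcount0 : ∀ B i, (b B).count (i, none) = 0 := by
    intro B i
    simp [b]
  have hsum : (∑ B, k B • ({b B} : Multiset (Multiset _))).sum ≤
      (T : Multiset (ι × Option (Config s K))) := by
    rw [Multiset.le_iff_count]
    rintro ⟨i, _ | B⟩
    · simp [Multiset.sum_sum, Multiset.sum_nsmul, Multiset.count_sum', Multiset.count_nsmul,
        hcount0]
    · simp only [Multiset.sum_sum, Multiset.sum_nsmul, Multiset.sum_singleton,
        Multiset.count_sum', Multiset.count_nsmul, hcount, mul_ite, mul_zero,
        Finset.sum_ite_eq', Finset.mem_univ, if_true]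
      rcases Nat.eq_zero_or_pos (B.1 i : ℕ) with h0 | hpos
      · simp [h0]
      rcases le_or_gt (n * (x B : ℝ) - Δ) 0 with hneg | hk
      · simp [k, Nat.floor_of_nonpos hneg]
      have h1 : (k B : ℝ) ≤ n * (x B : ℝ) - Δ := Nat.floor_le hk.le
      have h2 : |((T : Multiset _).count (i, some B) : ℝ) -
          n * (refinedWeight p x (i, some B) : ℝ)| ≤ Δ :=
        Finset.single_le_sum
          (f := fun τ => |((T : Multiset _).count τ : ℝ) - n * (refinedWeight p x τ : ℝ)|)
          (fun τ _ => abs_nonneg _) (Finset.mem_univ _)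
      have h3 := (abs_le.1 h2).1
      have h4 : (refinedWeight p x (i, some B) : ℝ) = x B * (B.1 i : ℕ) := by
        simp [refinedWeight]
      have h5 : (1 : ℝ) ≤ (B.1 i : ℕ) := by exact_mod_cast hpos
      have hΔ : 0 ≤ Δ := (abs_nonneg _).trans h2
      have : (k B : ℝ) * (B.1 i : ℕ) ≤ (T : Multiset _).count (i, some B) := by
        rw [h4] at h3
        nlinarith [mul_le_mul_of_nonneg_right h1 (zero_le_one.trans h5),
          mul_le_mul_of_nonneg_left h5 hΔ]
      exact_mod_cast this
  have hfill := canFill_of_sum_le (fun τ => (shrunkSize s K τ : ℝ)) _ (fun c hc => by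
    obtain ⟨B, -, hB⟩ := Multiset.mem_sum.1 hc
    rw [Multiset.mem_singleton.1 (Multiset.mem_of_mem_nsmul hB), hb]) T hsum
  have hcard : (∑ B, k B • ({b B} : Multiset (Multiset _))).card = ∑ B, k B := by
    simp
  rw [hcard] at hfill
  calc n * ∑ B, (x B : ℝ) - Fintype.card (Config s K) * (Δ + 1)
      = ∑ B, (n * (x B : ℝ) - Δ - 1) := by
        simp only [Finset.sum_sub_distrib, ← Finset.mul_sum, Finset.sum_const, Finset.card_univ,
          nsmul_eq_mul]
        ring
    _ ≤ ∑ B, (k B : ℝ) := Finset.sum_le_sum fun B _ => (Nat.sub_one_lt_floor _).le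
    _ ≤ opt (T.map fun τ => (shrunkSize s K τ : ℝ)) := by exact_mod_cast hfill.le_opt

theorem le_iidMean_opt_shrunkSize {p : ι → ℚ} (hp1 : ∑ i, p i = 1) {x : Config s K → ℚ}
    (hx0 : ∀ B, 0 ≤ x B) (hx : ∀ i, ∑ B, x B * (B.1 i : ℕ) ≤ p i) (n : ℕ) :
    n * ∑ B, (x B : ℝ) - Fintype.card (Config s K) *
      (Fintype.card (ι × Option (Config s K)) * √n + 1) ≤
      iidMean (fun τ => (refinedWeight p x τ : ℝ)) n
        fun T => (opt (T.map fun τ => (shrunkSize s K τ : ℝ)) : ℝ) := by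
  have hq0 : ∀ τ, (0 : ℝ) ≤ refinedWeight p x τ := fun τ => by
    exact_mod_cast refinedWeight_nonneg hx0 hx τ
  have hq1 : ∑ τ, (refinedWeight p x τ : ℝ) = 1 := by
    exact_mod_cast (sum_refinedWeight p x).trans hp1
  refine le_trans ?_ (iidMean_mono hq0 fun T _ => le_opt_map_shrunkSize p x n T)
  have hdev : ∑ τ, iidMean (fun τ => (refinedWeight p x τ : ℝ)) n
      (fun T => |((T : Multiset _).count τ : ℝ) - n * (refinedWeight p x τ : ℝ)|) ≤
      Fintype.card (ι × Option (Config s K)) * √n := by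
    simp only [Multiset.coe_count]
    refine (Finset.sum_le_sum fun τ _ => iidMean_abs_count_sub_le hq0 hq1 τ n).trans_eq ?_
    rw [Finset.sum_const, Finset.card_univ, nsmul_eq_mul]
  rw [iidMean_congr fun T _ => show _ = (n * ∑ B, (x B : ℝ) - Fintype.card (Config s K)) +
      (-(Fintype.card (Config s K) : ℝ)) * ∑ τ, |((T : Multiset _).count τ : ℝ) -
        n * (refinedWeight p x τ : ℝ)| by ring,
    iidMean_add, iidMean_const hq1, iidMean_mul_left, iidMean_sum]
  nlinarith [mul_le_mul_of_nonneg_left hdev (Nat.cast_nonneg (α := ℝ)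
    (Fintype.card (Config s K)))]

end Shrunk

theorem isLittleO_sqrt_add_const (a b : ℝ) :
    (fun n : ℕ => a * (b * √(n : ℝ) + 1)) =o[Filter.atTop] fun n : ℕ => (n : ℝ) := by
  have h1 : (fun n : ℕ => √(n : ℝ)) =o[Filter.atTop] fun n : ℕ => (n : ℝ) := by
    have h : (fun _ : ℕ => (1 : ℝ)) =o[Filter.atTop] fun n : ℕ => √(n : ℝ) :=
      Asymptotics.isLittleO_const_left.2 (Or.inr (tendsto_norm_atTop_atTop.comp
        (Real.tendsto_sqrt_atTop.comp tendsto_natCast_atTop_atTop)))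
    simpa using (Asymptotics.isBigO_refl (fun n : ℕ => √(n : ℝ)) Filter.atTop).mul_isLittleO h
  have h2 : (fun _ : ℕ => (1 : ℝ)) =o[Filter.atTop] fun n : ℕ => (n : ℝ) :=
    (Asymptotics.isLittleO_const_id_atTop (1 : ℝ)).comp_tendsto tendsto_natCast_atTop_atTop
  exact ((h1.const_mul_left b).add h2).const_mul_left a

namespace DiscreteDistribution

theorem exists_isPerfectPacking_ratio_le (F : DiscreteDistribution) (hF : F.IsNontrivial) :
    ∃ G : DiscreteDistribution, G.IsPerfectPacking ∧ G.IsNontrivial ∧ ∃ rF rG : ℝ,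
      Filter.Tendsto (fun n => expectedRatio dnf F n) Filter.atTop (nhds rF) ∧
      Filter.Tendsto (fun n => expectedRatio dnf G n) Filter.atTop (nhds rG) ∧ rG ≤ rF := by
  classical
  obtain ⟨K, hK⟩ : ∃ K : ℕ, ∀ i, 0 < F.size i → 1 ≤ K * F.size i := by
    refine ⟨∑ i, ⌈(F.size i)⁻¹⌉₊, fun i hi => ?_⟩
    have h1 : (F.size i)⁻¹ ≤ ((∑ i, ⌈(F.size i)⁻¹⌉₊ : ℕ) : ℚ) :=
      (Nat.le_ceil _).trans (Nat.cast_le.2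
        (Finset.single_le_sum (f := fun i => ⌈(F.size i)⁻¹⌉₊) (fun _ _ => Nat.zero_le _)
          (Finset.mem_univ i)))
    calc (1 : ℚ) = (F.size i)⁻¹ * F.size i := (inv_mul_cancel₀ hi.ne').symm
      _ ≤ _ := mul_le_mul_of_nonneg_right h1 hi.le
  have hp : ∀ i, 0 ≤ F.prob i := fun i => (F.prob_pos i).le
  obtain ⟨x, hx0, hx, hxmax⟩ := exists_optimal_packing
    (fun (B : Config F.size K) i => (B.1 i : ℕ)) (fun B => by
      by_contra! h
      have := B.2
      simp [h] at this
      norm_num at this) F.prob hp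
  set v : ℝ := ∑ B, (x B : ℝ)
  set q := refinedWeight F.prob x
  set t := shrunkSize F.size K
  have hq0 : ∀ τ, 0 ≤ q τ := refinedWeight_nonneg hx0 hx
  have hq0' : ∀ τ, (0 : ℝ) ≤ q τ := fun τ => by exact_mod_cast hq0 τ
  have hq1 : ∑ τ, q τ = 1 := (sum_refinedWeight F.prob x).trans F.prob_sum
  have hq1' : ∑ τ, (q τ : ℝ) = 1 := by exact_mod_cast hq1
  have ht0 : ∀ τ, 0 ≤ t τ := shrunkSize_nonneg F.size_nonneg
  have hqt : ∑ τ, q τ * t τ = ∑ B, x B := sum_refinedWeight_mul_shrunkSize F.prob x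
  have hqt' : ∑ τ, (q τ : ℝ) * (t τ : ℝ) = v := by
    simp only [v, ← Rat.cast_mul, ← Rat.cast_sum, hqt]
  obtain ⟨G, hG, hGnt⟩ := exists_of_weights q t hq0 hq1 ht0
  obtain ⟨oF, hoF0, hoF⟩ := F.exists_tendsto_expect_opt_div hF
  obtain ⟨dF, hdF⟩ := F.exists_tendsto_expect_dnf_div
  obtain ⟨dG, hdG⟩ := G.exists_tendsto_expect_dnf_div
  have hoFv : oF ≤ v := by
    refine le_of_tendsto hoF ?_
    filter_upwards [Filter.eventually_gt_atTop 0] with n hn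
    rw [div_le_iff₀ (by exact_mod_cast hn), expect_eq_iidMean, mul_comm]
    have := iidMean_opt_le F.size_nonneg hK hp F.prob_sum hxmax n
    rwa [Rat.cast_sum] at this
  have hv0 : 0 < v := hoF0.trans_le hoFv
  have hGnontrivial : G.IsNontrivial := by
    have hpos : 0 < ∑ τ, q τ * t τ := by
      rw [hqt]
      simp only [v, ← Rat.cast_sum] at hv0
      exact_mod_cast hv0
    obtain ⟨τ, -, hτ⟩ := Finset.exists_lt_of_sum_lt (f := fun _ => (0 : ℚ)) (by simpa using hpos)
    exact hGnt ⟨τ, (hq0 τ).lt_of_ne fun h => by simp [← h] at hτ,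
      (ht0 τ).lt_of_ne fun h => by simp [← h] at hτ⟩
  have hnn : ∀ (T : List (Fin F.m × Option (Config F.size K))),
      ∀ a ∈ T.map fun τ => (t τ : ℝ), 0 ≤ a := by
    intro T a ha
    obtain ⟨τ, -, rfl⟩ := List.mem_map.1 ha
    exact_mod_cast ht0 τ
  -- every configuration packed at rate `x B` contributes total size `1`, so the mean size is `v`
  have hwaste : ∀ n, G.expect n wasteOpt = n * v - G.expect n fun L => (opt L : ℝ) := by
    intro n
    simp only [hG, wasteOpt, sub_eq_add_neg]
    rw [iidMean_add, iidMean_sum_map hq1', hqt']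
    simp only [neg_eq_neg_one_mul (opt _ : ℝ)]
    rw [iidMean_mul_left]
    ring
  have hwaste0 : ∀ n, 0 ≤ G.expect n wasteOpt := fun n => by
    rw [hG]
    exact iidMean_nonneg hq0' fun T => wasteOpt_nonneg (hnn T)
  have hperfect : G.IsPerfectPacking := by
    refine Asymptotics.IsBigO.trans_isLittleO (Asymptotics.IsBigO.of_bound' ?_)
      (isLittleO_sqrt_add_const (Fintype.card (Config F.size K))
        (Fintype.card (Fin F.m × Option (Config F.size K))))
    refine Filter.Eventually.of_forall fun n => ?_
    rw [Real.norm_of_nonneg (hwaste0 n)]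
    refine le_trans ?_ (Real.le_norm_self _)
    have := le_iidMean_opt_shrunkSize F.prob_sum hx0 hx n
    rw [hwaste, hG]
    linarith
  have hoG : Filter.Tendsto (fun n : ℕ => G.expect n (fun L => (opt L : ℝ)) / n) Filter.atTop
      (nhds v) := by
    have h := (tendsto_const_nhds (x := v)).sub hperfect.tendsto_div_nhds_zero
    rw [sub_zero] at h
    refine h.congr' ?_
    filter_upwards [Filter.eventually_ne_atTop 0] with n hn
    have hn' : (n : ℝ) ≠ 0 := Nat.cast_ne_zero.2 hn
    rw [hwaste]
    field_simp
    ring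
  -- the coupling: the refined types carry both the original and the shrunk size of an item
  have hdFG : dG ≤ dF := by
    refine le_of_tendsto_of_tendsto' hdG hdF fun n => ?_
    refine div_le_div_of_nonneg_right ?_ (Nat.cast_nonneg n)
    rw [hG, expect_eq_iidMean, ← iidMean_map (q := fun τ => (q τ : ℝ)) Prod.fst]
    · refine iidMean_mono hq0' fun T _ => Nat.cast_le.2 (dnf_mono ?_)
      rw [List.map_map, List.forall₂_map_left_iff, List.forall₂_map_right_iff, List.forall₂_same]
      intro τ _
      exact ⟨by exact_mod_cast ht0 τ, Rat.cast_le.2 (shrunkSize_le F.size_nonneg τ)⟩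
    · intro i
      rw [← sum_refinedWeight_fst F.prob x i, Finset.sum_filter, Fintype.sum_prod_type]
      simp [q]
  have hdF0 : 0 ≤ dF := ge_of_tendsto' hdF fun n =>
    div_nonneg (F.expect_nonneg n fun _ => Nat.cast_nonneg _) (Nat.cast_nonneg n)
  exact ⟨G, hperfect, hGnontrivial, dF / oF, dG / v, tendsto_expectedRatio hdF hoF hoF0,
    tendsto_expectedRatio hdG hoG hv0, div_le_div₀ hdF0 hdFG hoF0 hoFv⟩

theorem aecr_nonneg {F : DiscreteDistribution} (hF : F.IsNontrivial) : 0 ≤ aecr dnf F := by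
  obtain ⟨-, -, -, r, -, hr, -, -⟩ := F.exists_isPerfectPacking_ratio_le hF
  rw [aecr, hr.liminf_eq]
  exact ge_of_tendsto' hr fun n => div_nonneg (F.expect_nonneg n fun _ => Nat.cast_nonneg _)
    (F.expect_nonneg n fun _ => Nat.cast_nonneg _)

theorem exists_isNontrivial : ∃ F : DiscreteDistribution, F.IsNontrivial :=
  ⟨{ m := 1, size := fun _ => 1, prob := fun _ => 1, size_nonneg := fun _ => zero_le_one,
     prob_pos := fun _ => one_pos, prob_sum := by simp }, 0, one_pos⟩

theorem aecrSet_isPerfectPacking_eq :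
    aecrSet dnf {G | G.IsPerfectPacking ∧ G.IsNontrivial} = aecrSet dnf {F | F.IsNontrivial} := by
  have hle : ∀ F : DiscreteDistribution, F.IsNontrivial →
      ∃ G : DiscreteDistribution, (G.IsPerfectPacking ∧ G.IsNontrivial) ∧
        aecr dnf G ≤ aecr dnf F := by
    intro F hF
    obtain ⟨G, hG, hG', rF, rG, hrF, hrG, h⟩ := F.exists_isPerfectPacking_ratio_le hF
    exact ⟨G, ⟨hG, hG'⟩, by rwa [aecr, aecr, hrF.liminf_eq, hrG.liminf_eq]⟩
  have hbdd : BddBelow (aecr dnf '' {F | F.IsNontrivial}) :=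
    ⟨0, by rintro _ ⟨F, hF, rfl⟩; exact aecr_nonneg hF⟩
  have hsub : aecr dnf '' {G | G.IsPerfectPacking ∧ G.IsNontrivial} ⊆
      aecr dnf '' {F | F.IsNontrivial} := Set.image_mono fun _ h => h.2
  obtain ⟨F₀, hF₀⟩ := exists_isNontrivial
  obtain ⟨G₀, hG₀, -⟩ := hle F₀ hF₀
  refine le_antisymm (le_csInf ⟨_, F₀, hF₀, rfl⟩ ?_) (csInf_le_csInf hbdd ⟨_, G₀, hG₀, rfl⟩ hsub)
  rintro _ ⟨F, hF, rfl⟩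
  obtain ⟨G, hG, h⟩ := hle F hF
  exact (csInf_le (hbdd.mono hsub) ⟨G, hG, rfl⟩).trans h

end DiscreteDistribution

end BinCovering

theorem mainTheorem9 :
    -- lists: a perfectly packable list is at least as bad in random order
    (∀ L : List ℝ, (∀ a ∈ L, 0 ≤ a ∧ a ≤ 1) → 0 < BinCovering.opt L →
      ∃ H : List ℝ, (∀ a ∈ H, 0 ≤ a ∧ a ≤ 1) ∧ 0 < BinCovering.opt H ∧
        BinCovering.wasteOpt H = 0 ∧
        BinCovering.randomOrderMean BinCovering.dnf H / (BinCovering.opt H : ℝ) ≤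
          BinCovering.randomOrderMean BinCovering.dnf L / (BinCovering.opt L : ℝ)) ∧
    -- distributions: both limits exist, and the one for `G` is at most the one for `F`
    (∀ F : BinCovering.DiscreteDistribution, F.IsNontrivial →
      ∃ G : BinCovering.DiscreteDistribution, G.IsPerfectPacking ∧ G.IsNontrivial ∧
        ∃ rF rG : ℝ,
          Filter.Tendsto
            (fun n => BinCovering.DiscreteDistribution.expectedRatio BinCovering.dnf F n)
            Filter.atTop (nhds rF) ∧
          Filter.Tendsto
            (fun n => BinCovering.DiscreteDistribution.expectedRatio BinCovering.dnf G n)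
            Filter.atTop (nhds rG) ∧
          rG ≤ rF) ∧
    -- perfect-packing distributions are the worst case
    BinCovering.DiscreteDistribution.aecrSet BinCovering.dnf
        {G | G.IsPerfectPacking ∧ G.IsNontrivial} =
      BinCovering.DiscreteDistribution.aecrSet BinCovering.dnf {F | F.IsNontrivial} :=
  ⟨BinCovering.exists_wasteOpt_eq_zero_ratio_le,
    BinCovering.DiscreteDistribution.exists_isPerfectPacking_ratio_le,
    BinCovering.DiscreteDistribution.aecrSet_isPerfectPacking_eq⟩
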